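/- Let $G$ be a locally compact (Hausdorff) abelian group, written additively, with Haar measure $dt$. A weight on $G$ is a continuous function $w\colon G\to(0,\infty)$ with $w(s+t)\le w(s)w(t)$ and $w(0)=1$. For a complex Banach space $X$ let $L^1_w(G,X)$ be the Banach space of (classes of) measurable functions $f\colon G\to X$ that are Bochner integrable for $w(t)\,dt$, with norm $\int_G\|f(t)\|w(t)\,dt$. Then $L^1_w(G)=L^1_w(G,\mathbb C)$ is a commutative Banach algebra under convolution (a Beurling algebra). Let $\omega$ and $\sigma$ be weights on $G$, put $\tilde\sigma(t)=\sigma(-t)$, and suppose that $\omega\ge 1$, $\omega\ge\sigma$ and $\omega\tilde\sigma\ge 1$. Let $X$ be an essential Banach $L^1_\sigma(G)$-module: $X$ is a complex Banach space with a bounded bilinear action $(f,x)\mapsto fx$ of $L^1_\sigma(G)$ satisfying $(f*g)x=f(gx)$, and the linear span of the elements $fx$ is dense in $X$. Then for every $t\in G$ there is exactly one bounded operator $x\mapsto\delta_t x$ on $X$ with $\delta_t(fx)=(\delta_t*f)x$ for all $f\in L^1_\sigma(G)$ and $x\in X$, where $(\delta_t*f)(s)=f(s-t)$; the map $t\mapsto\delta_t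 x$ is continuous for each $x\in X$; and the formulas $$\Lambda_X(f)(t)=\delta_{-t}[f(t)],\qquad \Phi(f)=\int_G f(t)\,dt,\qquad \Pi(g)=\int_G\delta_t[g(t)]\,dt$$ define bounded linear operators $\Lambda_X\colon L^1_{\omega\tilde\sigma}(G,X)\to L^1_\omega(G,X)$, $\Phi\colon L^1_{\omega\tilde\sigma}(G,X)\to X$ and $\Pi\colon L^1_\omega(G,X)\to X$. Moreover, $\Lambda_X(\ker\Phi)$ is a dense subset of $\ker\Pi$. If in addition $\sigma=1$, then $\Lambda_X(\ker\Phi)=\ker\Pi$. -/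

import Mathlib

open MeasureTheory Filter Topology
open scoped ENNReal

namespace Beurling

/-- A weight on an (additively written) abelian topological group: a continuous, strictly positive,
submultiplicative function taking the value `1` at the neutral element. -/
structure IsWeight {G : Type*} [AddCommGroup G] [TopologicalSpace G] (w : G → ℝ) : Prop where
  continuous : Continuous w
  pos : ∀ t, 0 < w t
  submul : ∀ s t, w (s + t) ≤ w s * w t
  zero : w 0 = 1

/-- The measure `w μ`, i.e. `E ↦ ∫_E w dμ`. -/
noncomputable def weightedMeasure {G : Type*} [MeasurableSpace G] (μ : Measure G) (w : G → ℝ) :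
    Measure G :=
  μ.withDensity fun t => ENNReal.ofReal (w t)

/-- The Banach space `L¹_w(G, X)` of (classes of) Bochner `w μ`-integrable functions, with the
norm `∫ ‖f t‖ w t dμ`. The Beurling algebra `L¹_w(G)` is the case `X = ℂ`. -/
noncomputable abbrev L1 {G : Type*} [MeasurableSpace G] (μ : Measure G) (w : G → ℝ)
    (X : Type*) [NormedAddCommGroup X] : Type _ :=
  Lp X 1 (weightedMeasure μ w)

section Translate

variable {G : Type*} [AddCommGroup G] [TopologicalSpace G] [IsTopologicalAddGroup G]
  [MeasurableSpace G] [BorelSpace G] {μ : Measure G} [μ.IsAddLeftInvariant] {w : G → ℝ}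

theorem memLp_translate (hw : IsWeight w) (t : G) (f : L1 μ w ℂ) :
    MemLp (fun s => f (s - t)) 1 (weightedMeasure μ w) := by
  have hm : Measurable fun s => ENNReal.ofReal (w s) := hw.continuous.measurable.ennreal_ofReal
  have hpos : ∀ s, ENNReal.ofReal (w s) ≠ 0 := fun s => by simpa using hw.pos s
  have hac : μ ≪ weightedMeasure μ w :=
    withDensity_absolutelyContinuous' hm.aemeasurable (ae_of_all _ hpos)
  have hf : MemLp f 1 (weightedMeasure μ w) := Lp.memLp f
  have hfμ : AEStronglyMeasurable f μ := hf.1.mono_ac hac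
  have hmp : MeasurePreserving (fun s : G => s - t) μ μ := measurePreserving_sub_right μ t
  have hfs : AEStronglyMeasurable (fun s => f (s - t)) μ := hfμ.comp_measurePreserving hmp
  refine ⟨hfs.mono_ac (withDensity_absolutelyContinuous _ _), ?_⟩
  have hfin := hf.2
  rw [eLpNorm_one_eq_lintegral_enorm] at hfin ⊢
  unfold weightedMeasure at hfin ⊢
  have hlt : ∀ s, ENNReal.ofReal (w s) < ∞ := fun s => ENNReal.ofReal_lt_top
  rw [lintegral_withDensity_eq_lintegral_mul_non_measurable _ hm (ae_of_all _ hlt)] at hfin ⊢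
  set F : G → ℝ≥0∞ := (fun s => ENNReal.ofReal (w s)) * fun s => ‖f s‖ₑ with hF
  have hFm : AEMeasurable F μ := hm.aemeasurable.mul hfμ.enorm
  calc ∫⁻ s, ((fun s => ENNReal.ofReal (w s)) * fun s => ‖f (s - t)‖ₑ) s ∂μ
      ≤ ∫⁻ s, ENNReal.ofReal (w t) * F (s - t) ∂μ := by
        refine lintegral_mono fun s => ?_
        simp only [hF, Pi.mul_apply]
        rw [← mul_assoc, ← ENNReal.ofReal_mul (hw.pos t).le]
        gcongr
        have := hw.submul t (s - t)
        rwa [add_sub_cancel] at this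
    _ = ENNReal.ofReal (w t) * ∫⁻ s, F s ∂μ := by
        rw [lintegral_const_mul' _ _ ENNReal.ofReal_ne_top]
        congr 1
        have h := lintegral_map' (μ := μ) (f := F) (g := fun s : G => s - t)
          (by rw [hmp.map_eq]; exact hFm) hmp.measurable.aemeasurable
        rw [hmp.map_eq] at h
        exact h.symm
    _ < ∞ := ENNReal.mul_lt_top ENNReal.ofReal_lt_top hfin

/-- The translate `δ_t * f`, i.e. `s ↦ f (s - t)`, as an element of the Beurling algebra. -/
noncomputable def translate (hw : IsWeight w) (t : G) (f : L1 μ w ℂ) : L1 μ w ℂ :=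
  (memLp_translate hw t f).toLp _

end Translate

section Modules

variable {G : Type*} [AddCommGroup G] [TopologicalSpace G] [IsTopologicalAddGroup G]
  [MeasurableSpace G] [BorelSpace G] {μ : Measure G} {w : G → ℝ}

/-- `h` is the product of `f` and `g` in the Beurling algebra:
`h s = ∫ f t * g (s - t) dμ(t)` for almost every `s`. -/
def IsConvolution (f g h : L1 μ w ℂ) : Prop :=
  h =ᵐ[μ] fun s => ∫ t, f t * g (s - t) ∂μ

/-- A Banach module over the commutative Banach algebra `L¹_w(G)`, on the Banach space `X`: a
bounded bilinear action `(f, x) ↦ f x` with `(f * g) x = f (g x)`. -/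
structure BanachModule (μ : Measure G) (w : G → ℝ) (X : Type*) [NormedAddCommGroup X]
    [NormedSpace ℂ X] where
  act : L1 μ w ℂ →L[ℂ] X →L[ℂ] X
  act_conv : ∀ f g h : L1 μ w ℂ, IsConvolution f g h → ∀ x : X, act h x = act f (act g x)

namespace BanachModule

variable {X : Type*} [NormedAddCommGroup X] [NormedSpace ℂ X]

/-- `X` is the closed linear span of the elements `f x`. -/
def IsEssential (M : BanachModule μ w X) : Prop :=
  Dense (Submodule.span ℂ {y : X | ∃ (f : L1 μ w ℂ) (x : X), M.act f x = y} : Set X)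

/-- `T` is the action of the point mass `δ_t` on `X`: a bounded operator with
`δ_t (f x) = (δ_t * f) x`. -/
def IsPointAction [μ.IsAddLeftInvariant] (M : BanachModule μ w X) (hw : IsWeight w) (t : G)
    (T : X →L[ℂ] X) : Prop :=
  ∀ (f : L1 μ w ℂ) (x : X), T (M.act f x) = M.act (translate hw t f) x

theorem IsPointAction.unique [μ.IsAddLeftInvariant] {M : BanachModule μ w X} (hM : M.IsEssential)
    {hw : IsWeight w} {t : G} {S T : X →L[ℂ] X} (hS : M.IsPointAction hw t S)
    (hT : M.IsPointAction hw t T) : S = T := by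
  refine ContinuousLinearMap.ext_on hM ?_
  rintro _ ⟨f, x, rfl⟩
  rw [hS f x, hT f x]

open Classical in
/-- The action of `δ_t` on an essential module (unique by `IsPointAction.unique`). The value `0`
is a default for the case that there is no such operator. -/
noncomputable def pointAct [μ.IsAddLeftInvariant] (M : BanachModule μ w X) (hw : IsWeight w)
    (t : G) : X →L[ℂ] X :=
  if h : ∃ T, M.IsPointAction hw t T then h.choose else 0

end BanachModule

end Modules

end Beurling

/-!
The action of a point mass `δ_t` on an essential module is obtained from a bounded approximate
identity `(E i)` of `L¹_σ(G)` consisting of bumps shrinking to `0`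
(`Beurling.exists_approximate_identity`). Since `(δ_t * E i) * f = δ_t * (E i * f)`, the uniformly
bounded operators `x ↦ (δ_t * E i) x` converge to `(δ_t * f) x` on the elements `f x`. Hence
`∑ fᵢ xᵢ ↦ ∑ (δ_t * fᵢ) xᵢ` is well defined and bounded on a dense subspace, with norm at most
`C σ(t)` (`Beurling.BanachModule.exists_isPointAction`). Uniqueness gives `δ_s δ_t = δ_{s+t}`, and
strong continuity follows from the continuity of translation on `C_c(G)` and the norm bound.

Joint continuity of `(t, x) ↦ δ_t x` makes `t ↦ δ_t (f t)` measurable, being an almost everywhere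
limit of functions in `C_c(G, X)`. The bound `‖δ_t‖ ≤ C σ(t)` then shows that `Λ_X` and `Π` are
bounded. From `δ_t δ_{-t} = 1` one gets `Π ∘ Λ_X = Φ`, so `Λ_X` maps `ker Φ` into `ker Π`. The range
of `Λ_X` contains `C_c(G, X)` and is therefore dense, while `Φ` is onto; by the open mapping theorem
these two facts make the image of `ker Φ` dense in `ker Π`
(`Beurling.ker_subset_closure_image_ker`). For `σ = 1` the operators `δ_t` are uniformly bounded, so
that `g ↦ (t ↦ δ_t (g t))` is an inverse of `Λ_X` and the image is all of `ker Π`.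

`G` need not be second countable or `σ`-compact, so Fubini's theorem and the strong measurability of
general continuous functions are not available. All explicit computations are made with functions in
`C_c`, which are dense (`Beurling.dense_ccSet`), and estimates use uniform continuity instead of
interchanging integrals.
-/

namespace Beurling

open scoped Pointwise

/-! ### Weighted `L¹` spaces -/

section WeightedL1

variable {G : Type*} [TopologicalSpace G] [MeasurableSpace G] [BorelSpace G] {μ : Measure G}
  {w w' : G → ℝ} {E F : Type*} [NormedAddCommGroup E] [NormedAddCommGroup F]

theorem ae_weightedMeasure (hw : Continuous w) (hp : ∀ t, 0 < w t) :
    ae (weightedMeasure μ w) = ae μ := by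
  refine le_antisymm (withDensity_absolutelyContinuous _ _).ae_le ?_
  exact (withDensity_absolutelyContinuous' hw.measurable.ennreal_ofReal.aemeasurable
    (ae_of_all _ fun s => by simpa using hp s)).ae_le

theorem aestronglyMeasurable (hw : Continuous w) (hp : ∀ t, 0 < w t) (f : L1 μ w E) :
    AEStronglyMeasurable f μ :=
  (Lp.aestronglyMeasurable f).mono_ac
    (withDensity_absolutelyContinuous' hw.measurable.ennreal_ofReal.aemeasurable
      (ae_of_all _ fun s => by simpa using hp s))

theorem ext_ae (hw : Continuous w) (hp : ∀ t, 0 < w t) {f g : L1 μ w E} (h : f =ᵐ[μ] g) :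
    f = g :=
  Lp.ext (by rwa [EventuallyEq, ae_weightedMeasure hw hp])

theorem coeFn_toLp (hw : Continuous w) (hp : ∀ t, 0 < w t) {f : G → E}
    (hf : MemLp f 1 (weightedMeasure μ w)) : hf.toLp f =ᵐ[μ] f := by
  have h := hf.coeFn_toLp
  rwa [EventuallyEq, ae_weightedMeasure hw hp] at h

theorem coeFn_add (hw : Continuous w) (hp : ∀ t, 0 < w t) (f g : L1 μ w E) :
    ⇑(f + g) =ᵐ[μ] fun t => f t + g t := by
  have h := Lp.coeFn_add f g
  rwa [EventuallyEq, ae_weightedMeasure hw hp] at h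

theorem coeFn_sub (hw : Continuous w) (hp : ∀ t, 0 < w t) (f g : L1 μ w E) :
    ⇑(f - g) =ᵐ[μ] fun t => f t - g t := by
  have h := Lp.coeFn_sub f g
  rwa [EventuallyEq, ae_weightedMeasure hw hp] at h

theorem norm_eq_integral (hw : Continuous w) (hp : ∀ t, 0 < w t) (f : L1 μ w E) :
    ‖f‖ = ∫ t, w t * ‖f t‖ ∂μ := by
  rw [L1.norm_eq_integral_norm]
  refine (integral_withDensity_eq_integral_smul (μ := μ) hw.measurable.real_toNNReal _).trans ?_
  simp only [NNReal.smul_def, Real.coe_toNNReal _ (hp _).le, smul_eq_mul]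

variable [NormedSpace ℂ E] [NormedSpace ℂ F]

theorem memLp_weighted_iff (hw : Continuous w) (hp : ∀ t, 0 < w t) {f : G → E} :
    MemLp f 1 (weightedMeasure μ w) ↔ Integrable (fun t => w t • f t) μ := by
  have h := integrable_withDensity_iff_integrable_smul (μ := μ) (g := f) hw.measurable.real_toNNReal
  rw [memLp_one_iff_integrable]
  refine h.trans (integrable_congr (ae_of_all _ fun t => ?_))
  simp only [NNReal.smul_def, Real.coe_toNNReal _ (hp t).le]

theorem integrable_smul (hw : Continuous w) (hp : ∀ t, 0 < w t) (f : L1 μ w E) :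
    Integrable (fun t => w t • f t) μ :=
  (memLp_weighted_iff hw hp).1 (Lp.memLp f)

theorem coeFn_smul (hw : Continuous w) (hp : ∀ t, 0 < w t) (c : ℂ) (f : L1 μ w E) :
    ⇑(c • f) =ᵐ[μ] fun t => c • f t := by
  have h := Lp.coeFn_smul c f
  rwa [EventuallyEq, ae_weightedMeasure hw hp] at h

theorem integrable_mul_norm (hw : Continuous w) (hp : ∀ t, 0 < w t) (f : L1 μ w E) :
    Integrable (fun t => w t * ‖f t‖) μ := by
  refine (integrable_smul hw hp f).norm.congr (ae_of_all _ fun t => ?_)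
  simp [norm_smul, abs_of_pos (hp t)]

/-- The classes of continuous functions with compact support. -/
def ccSet (μ : Measure G) (w : G → ℝ) (E : Type*) [NormedAddCommGroup E] : Set (L1 μ w E) :=
  {f | ∃ g : G → E, Continuous g ∧ HasCompactSupport g ∧ f =ᵐ[μ] g}

theorem memLp_cc [IsFiniteMeasureOnCompacts μ] (hw : Continuous w) (hp : ∀ t, 0 < w t)
    {g : G → E} (hg : Continuous g) (hc : HasCompactSupport g) :
    MemLp g 1 (weightedMeasure μ w) :=
  (memLp_weighted_iff hw hp).2 <| (hw.smul hg).integrable_of_hasCompactSupport hc.smul_left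

/-- Density of `C_c` in `L¹`, for a locally compact Hausdorff space that need not be normal: Urysohn's
lemma is applied to a compact set inside an open set, both close in measure to a given set. -/
theorem _root_.MeasureTheory.Integrable.exists_continuous_hasCompactSupport_integral_sub_le
    [T2Space G] [LocallyCompactSpace G] [μ.Regular] {f : G → E} (hf : Integrable f μ) {ε : ℝ}
    (hε : 0 < ε) :
    ∃ g : G → E, Continuous g ∧ HasCompactSupport g ∧ ∫ t, ‖f t - g t‖ ∂μ ≤ ε := by
  have hε' : ENNReal.ofReal ε ≠ 0 := (ENNReal.ofReal_pos.2 hε).ne'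
  suffices H : ∃ g : G → E, eLpNorm (f - g) 1 μ ≤ ENNReal.ofReal ε ∧
      (Continuous g ∧ HasCompactSupport g) by
    obtain ⟨g, hgε, hg, hgc⟩ := H
    refine ⟨g, hg, hgc, ?_⟩
    change ∫ t, ‖(f - g) t‖ ∂μ ≤ ε
    rw [integral_norm_eq_lintegral_enorm
      (hf.1.sub (hg.stronglyMeasurable_of_hasCompactSupport hgc).aestronglyMeasurable)]
    rw [eLpNorm_one_eq_lintegral_enorm] at hgε
    exact ENNReal.toReal_le_of_le_ofReal hε.le hgε
  refine (memLp_one_iff_integrable.2 hf).induction_dense ENNReal.one_ne_top _ ?_ ?_ ?_ hε'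
  rotate_left
  · exact fun f g hf hg => ⟨hf.1.add hg.1, hf.2.add hg.2⟩
  · exact fun g hg => (hg.1.stronglyMeasurable_of_hasCompactSupport hg.2).aestronglyMeasurable
  intro c s hs hsμ δ hδ
  obtain ⟨η, ηpos, hη⟩ := exists_eLpNorm_indicator_le (μ := μ) ENNReal.one_ne_top c hδ
  have hη2 : (η : ℝ≥0∞) / 2 ≠ 0 := by simpa using ηpos.ne'
  obtain ⟨K, hKs, hK, hKμ⟩ := hs.exists_isCompact_sdiff_lt hsμ.ne hη2
  obtain ⟨V, hKV, hV, -, hVμ⟩ := hK.measurableSet.exists_isOpen_sdiff_lt (μ := μ)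
    hK.measure_lt_top.ne hη2
  obtain ⟨φ, hφK, hφV, hφc, hφ⟩ := exists_continuous_one_zero_of_isCompact hK hV.isClosed_compl
    (Set.disjoint_compl_right_iff_subset.2 hKV)
  refine ⟨fun t => φ t • c, ?_, φ.continuous.smul continuous_const, hφc.smul_right⟩
  -- the error is at most `‖c‖`, and vanishes off `s \ K ∪ V \ K`
  refine le_trans (eLpNorm_mono fun t => ?_) (hη (s \ K ∪ V \ K) ?_)
  · by_cases htK : t ∈ K
    · simp [hφK htK, hKs htK]
    by_cases htV : t ∈ V
    · rw [Set.indicator_of_mem (show t ∈ s \ K ∪ V \ K from Or.inr ⟨htV, htK⟩)]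
      have h0 := (hφ t).1
      have h1 := (hφ t).2
      have : ∃ a : ℝ, |a| ≤ 1 ∧ ((fun t => φ t • c) - s.indicator fun _ => c) t = a • c := by
        by_cases hts : t ∈ s
        · exact ⟨φ t - 1, abs_le.2 ⟨by linarith, by linarith⟩, by simp [hts, sub_smul]⟩
        · exact ⟨φ t, abs_le.2 ⟨by linarith, h1⟩, by simp [hts]⟩
      obtain ⟨a, ha, h⟩ := this
      rw [h, norm_smul]
      exact mul_le_of_le_one_left (norm_nonneg _) ha
    · have h0 : φ t = 0 := hφV htV
      by_cases hts : t ∈ s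
      · rw [Set.indicator_of_mem (show t ∈ s \ K ∪ V \ K from Or.inl ⟨hts, htK⟩)]
        simp [h0, hts]
      · simp [h0, hts]
  · calc μ (s \ K ∪ V \ K) ≤ μ (s \ K) + μ (V \ K) := measure_union_le _ _
      _ ≤ η / 2 + η / 2 := add_le_add hKμ.le hVμ.le
      _ = η := ENNReal.add_halves _

theorem dense_ccSet [T2Space G] [LocallyCompactSpace G] [μ.Regular] (hw : Continuous w)
    (hp : ∀ t, 0 < w t) : Dense (ccSet μ w E) := by
  refine Metric.dense_iff.2 fun f ε hε => ?_
  -- an approximant `g` of `w f` in `L¹(μ)` gives the approximant `w⁻¹ g` of `f`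
  obtain ⟨g, hg, hgc, hgε⟩ :=
    (integrable_smul hw hp f).exists_continuous_hasCompactSupport_integral_sub_le (half_pos hε)
  have hg' : Continuous fun t => (w t)⁻¹ • g t := (hw.inv₀ fun t => (hp t).ne').smul hg
  have hgc' : HasCompactSupport fun t => (w t)⁻¹ • g t := hgc.smul_left
  have hm := memLp_cc (μ := μ) hw hp hg' hgc'
  refine ⟨hm.toLp _, ?_, _, hg', hgc', coeFn_toLp hw hp hm⟩
  rw [Metric.mem_ball, dist_comm, dist_eq_norm, norm_eq_integral hw hp]
  refine lt_of_le_of_lt (le_of_eq_of_le (integral_congr_ae ?_) hgε) (half_lt_self hε)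
  filter_upwards [coeFn_sub hw hp f (hm.toLp _), coeFn_toLp hw hp hm] with t h1 h2
  rw [h1, h2]
  nth_rw 1 [← abs_of_pos (hp t)]
  rw [← Real.norm_eq_abs, ← norm_smul, smul_sub, smul_inv_smul₀ (hp t).ne']

/-- Every class in `L¹_w` is the almost everywhere limit of a sequence in `C_c`. -/
theorem exists_seq_cc_tendsto_ae [T2Space G] [LocallyCompactSpace G] [μ.Regular]
    (hw : Continuous w) (hp : ∀ t, 0 < w t) (f : L1 μ w E) :
    ∃ g : ℕ → G → E, (∀ n, Continuous (g n)) ∧ (∀ n, HasCompactSupport (g n)) ∧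
      ∀ᵐ t ∂μ, Tendsto (fun n => g n t) atTop (𝓝 (f t)) := by
  obtain ⟨F, hF, hlim⟩ := mem_closure_iff_seq_limit.1 (dense_ccSet (μ := μ) (E := E) hw hp f)
  choose g hg hgc hFg using hF
  obtain ⟨n, -, hn⟩ := (tendstoInMeasure_of_tendsto_Lp hlim).exists_seq_tendsto_ae
  rw [ae_weightedMeasure hw hp] at hn
  refine ⟨fun k => g (n k), fun k => hg _, fun k => hgc _, ?_⟩
  filter_upwards [hn, ae_all_iff.2 hFg] with t ht h
  simpa only [h] using ht

theorem memLp_of_norm_le (hw : Continuous w) (hp : ∀ t, 0 < w t) (hw' : Continuous w')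
    (hp' : ∀ t, 0 < w' t) (f : L1 μ w E) {h : G → F} (hh : AEStronglyMeasurable h μ) {C : ℝ}
    (hC : ∀ t, w' t * ‖h t‖ ≤ C * (w t * ‖f t‖)) : MemLp h 1 (weightedMeasure μ w') := by
  rw [memLp_weighted_iff hw' hp']
  refine ((integrable_mul_norm hw hp f).const_mul C).mono'
    (hw'.aestronglyMeasurable.smul hh) (ae_of_all _ fun t => ?_)
  rw [norm_smul, Real.norm_of_nonneg (hp' t).le]
  exact hC t

theorem norm_toLp_le (hw : Continuous w) (hp : ∀ t, 0 < w t) (hw' : Continuous w')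
    (hp' : ∀ t, 0 < w' t) (f : L1 μ w E) {h : G → F} (hm : MemLp h 1 (weightedMeasure μ w'))
    {C : ℝ} (hC : ∀ t, w' t * ‖h t‖ ≤ C * (w t * ‖f t‖)) : ‖hm.toLp h‖ ≤ C * ‖f‖ := by
  rw [norm_eq_integral hw' hp', norm_eq_integral hw hp, ← integral_const_mul]
  refine integral_mono_ae (integrable_mul_norm hw' hp' _)
    ((integrable_mul_norm hw hp f).const_mul C) ?_
  filter_upwards [coeFn_toLp hw' hp' hm] with t ht
  rw [ht]
  exact hC t

/-- Without countability assumptions on `G`, measurability comes from the approximation of `f` by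
functions `g n` in `C_c`, for which `t ↦ A t (g n t)` is again in `C_c`. -/
theorem aestronglyMeasurable_fiberwise [T2Space G] [LocallyCompactSpace G] [μ.Regular]
    (hw : Continuous w) (hp : ∀ t, 0 < w t) {A : G → E →L[ℂ] F}
    (hA : Continuous fun p : G × E => A p.1 p.2) (f : L1 μ w E) :
    AEStronglyMeasurable (fun t => A t (f t)) μ := by
  obtain ⟨g, hg, hgc, hlim⟩ := exists_seq_cc_tendsto_ae hw hp f
  refine aestronglyMeasurable_of_tendsto_ae atTop (f := fun n t => A t (g n t)) (fun n => ?_) ?_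
  · refine (Continuous.stronglyMeasurable_of_hasCompactSupport
      (hA.comp (continuous_id.prodMk (hg n))) ?_).aestronglyMeasurable
    exact (hgc n).mono fun t ht h => ht (by simp [h])
  · filter_upwards [hlim] with t ht
    exact ((A t).continuous.tendsto _).comp ht

section FiberwiseMap

variable [T2Space G] [LocallyCompactSpace G] [μ.Regular]
  (hw : Continuous w) (hp : ∀ t, 0 < w t) (hw' : Continuous w') (hp' : ∀ t, 0 < w' t)
  {A : G → E →L[ℂ] F} (hA : Continuous fun p : G × E => A p.1 p.2) {C : ℝ}
  (hC : ∀ t, w' t * ‖A t‖ ≤ C * w t)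

omit [TopologicalSpace G] [MeasurableSpace G] [BorelSpace G] [T2Space G]
  [LocallyCompactSpace G] in
include hp' hC in
theorem fiberwise_bound (f : G → E) (t : G) : w' t * ‖A t (f t)‖ ≤ C * (w t * ‖f t‖) :=
  calc w' t * ‖A t (f t)‖ ≤ w' t * (‖A t‖ * ‖f t‖) :=
        mul_le_mul_of_nonneg_left ((A t).le_opNorm _) (hp' t).le
    _ = (w' t * ‖A t‖) * ‖f t‖ := by ring
    _ ≤ (C * w t) * ‖f t‖ := mul_le_mul_of_nonneg_right (hC t) (norm_nonneg _)
    _ = C * (w t * ‖f t‖) := by ring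

include hw hp hw' hp' hA hC in
theorem memLp_fiberwise (f : L1 μ w E) :
    MemLp (fun t => A t (f t)) 1 (weightedMeasure μ w') :=
  memLp_of_norm_le hw hp hw' hp' f (aestronglyMeasurable_fiberwise hw hp hA f)
    (fiberwise_bound hp' hC f)

/-- The operator `L¹_w(G, E) → L¹_{w'}(G, F)` that applies, at each point `t`, a bounded operator
`A t` depending continuously on `t`. -/
noncomputable def fiberwise : L1 μ w E →L[ℂ] L1 μ w' F :=
  have hm := memLp_fiberwise (μ := μ) hw hp hw' hp' hA hC
  LinearMap.mkContinuous
    { toFun := fun f => (hm f).toLp _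
      map_add' := fun f g => by
        refine ext_ae hw' hp' ?_
        filter_upwards [coeFn_toLp hw' hp' (hm (f + g)), coeFn_add hw' hp' ((hm f).toLp _)
          ((hm g).toLp _), coeFn_add hw hp f g, coeFn_toLp hw' hp' (hm f),
          coeFn_toLp hw' hp' (hm g)] with t h1 h2 h3 h4 h5
        rw [h1, h2, h3, h4, h5, map_add]
      map_smul' := fun c f => by
        refine ext_ae hw' hp' ?_
        filter_upwards [coeFn_toLp hw' hp' (hm (c • f)), coeFn_smul hw' hp' c ((hm f).toLp _),
          coeFn_smul hw hp c f, coeFn_toLp hw' hp' (hm f)] with t h1 h2 h3 h4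
        rw [h1, RingHom.id_apply, h2, h3, h4, map_smul] }
    C fun f => norm_toLp_le hw hp hw' hp' f (hm f) (fiberwise_bound hp' hC f)

theorem coeFn_fiberwise (f : L1 μ w E) :
    fiberwise hw hp hw' hp' hA hC f =ᵐ[μ] fun t => A t (f t) :=
  coeFn_toLp hw' hp' (memLp_fiberwise hw hp hw' hp' hA hC f)

end FiberwiseMap

section Integral

variable (hw : Continuous w) (h1 : ∀ t, 1 ≤ w t)

include hw h1 in
theorem integrable_of_one_le (f : L1 μ w E) : Integrable f μ := by
  have hp : ∀ t, 0 < w t := fun t => one_pos.trans_le (h1 t)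
  exact (integrable_mul_norm hw hp f).mono' (aestronglyMeasurable hw hp f)
    (ae_of_all _ fun t => le_mul_of_one_le_left (norm_nonneg _) (h1 t))

/-- Integration with respect to `μ`, as a bounded operator on `L¹_w(G, E)` for `w ≥ 1`. -/
noncomputable def integralL1 : L1 μ w E →L[ℂ] E :=
  have hp : ∀ t, 0 < w t := fun t => one_pos.trans_le (h1 t)
  LinearMap.mkContinuous
    { toFun := fun f => ∫ t, f t ∂μ
      map_add' := fun f g => by
        rw [integral_congr_ae (coeFn_add hw hp f g),
          integral_add (integrable_of_one_le hw h1 f) (integrable_of_one_le hw h1 g)]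
      map_smul' := fun c f => by
        rw [integral_congr_ae (coeFn_smul hw hp c f), integral_smul, RingHom.id_apply] }
    1 fun f => by
      rw [one_mul, norm_eq_integral hw hp]
      refine norm_integral_le_of_norm_le (integrable_mul_norm hw hp f) (ae_of_all _ fun t => ?_)
      exact le_mul_of_one_le_left (norm_nonneg _) (h1 t)

theorem integralL1_apply (f : L1 μ w E) : integralL1 hw h1 f = ∫ t, f t ∂μ := rfl

end Integral

end WeightedL1
/-! ### Translations and approximate identities in a Beurling algebra -/

section Algebra

variable {G : Type*} [AddCommGroup G] [TopologicalSpace G] [IsTopologicalAddGroup G]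
  [MeasurableSpace G] [BorelSpace G] {μ : Measure G} {w : G → ℝ}

section Translate

variable [μ.IsAddLeftInvariant] (hw : IsWeight w)

theorem coeFn_translate (t : G) (f : L1 μ w ℂ) :
    translate hw t f =ᵐ[μ] fun s => f (s - t) :=
  coeFn_toLp hw.continuous hw.pos (memLp_translate hw t f)

theorem ae_comp_sub_right {p : G → Prop} (h : ∀ᵐ s ∂μ, p s) (t : G) : ∀ᵐ s ∂μ, p (s - t) :=
  (measurePreserving_sub_right μ t).quasiMeasurePreserving.ae h

theorem norm_translate_le (t : G) (f : L1 μ w ℂ) : ‖translate hw t f‖ ≤ w t * ‖f‖ := by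
  have hi := integrable_mul_norm hw.continuous hw.pos f
  rw [norm_eq_integral hw.continuous hw.pos, norm_eq_integral hw.continuous hw.pos,
    ← integral_sub_right_eq_self (fun s => w s * ‖f s‖) t, ← integral_const_mul]
  refine integral_mono_ae (integrable_mul_norm hw.continuous hw.pos _)
    ((hi.comp_sub_right t).const_mul _) ?_
  filter_upwards [coeFn_translate hw t f] with s hs
  rw [hs, ← mul_assoc]
  refine mul_le_mul_of_nonneg_right ?_ (norm_nonneg _)
  simpa using hw.submul t (s - t)

/-- Translation by `t` as a bounded operator on `L¹_w(G)`. -/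
noncomputable def translateL (t : G) : L1 μ w ℂ →L[ℂ] L1 μ w ℂ :=
  LinearMap.mkContinuous
    { toFun := translate hw t
      map_add' := fun f g => by
        refine ext_ae hw.continuous hw.pos ?_
        filter_upwards [coeFn_translate hw t (f + g), coeFn_translate hw t f,
          coeFn_translate hw t g,
          coeFn_add hw.continuous hw.pos (translate hw t f) (translate hw t g),
          ae_comp_sub_right (coeFn_add hw.continuous hw.pos f g) t] with s h1 h2 h3 h4 h5
        rw [h1, h4, h5, h2, h3]
      map_smul' := fun c f => by
        refine ext_ae hw.continuous hw.pos ?_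
        filter_upwards [coeFn_translate hw t (c • f), coeFn_translate hw t f,
          coeFn_smul hw.continuous hw.pos c (translate hw t f),
          ae_comp_sub_right (coeFn_smul hw.continuous hw.pos c f) t] with s h1 h2 h3 h4
        rw [h1, RingHom.id_apply, h3, h4, h2] }
    (w t) (norm_translate_le hw t)

theorem translateL_apply (t : G) (f : L1 μ w ℂ) : translateL hw t f = translate hw t f := rfl

theorem translate_translate (s t : G) (f : L1 μ w ℂ) :
    translate hw s (translate hw t f) = translate hw (s + t) f := by
  refine ext_ae hw.continuous hw.pos ?_
  filter_upwards [coeFn_translate hw s (translate hw t f), coeFn_translate hw (s + t) f,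
    ae_comp_sub_right (coeFn_translate hw t f) s] with u h1 h2 h3
  rw [h1, h2, h3, sub_sub]

theorem translate_zero (f : L1 μ w ℂ) : translate hw 0 f = f := by
  refine ext_ae hw.continuous hw.pos ?_
  filter_upwards [coeFn_translate hw 0 f] with s h
  rw [h, sub_zero]

theorem IsConvolution.translate {f g h : L1 μ w ℂ} (H : IsConvolution f g h) (t : G) :
    IsConvolution (translate hw t f) g (translate hw t h) := by
  filter_upwards [coeFn_translate hw t h, ae_comp_sub_right H t] with s h1 h2
  rw [h1, h2, ← integral_sub_right_eq_self (fun u => f u * g (s - t - u)) t]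
  refine integral_congr_ae ?_
  filter_upwards [coeFn_translate hw t f] with u hu
  rw [hu, sub_sub_sub_cancel_right]

/-- Translates of a function in `C_c(G)` depend continuously on the translation parameter. -/
theorem continuous_translate_of_mem_ccSet [LocallyCompactSpace G] [IsFiniteMeasureOnCompacts μ]
    {F : L1 μ w ℂ} (hF : F ∈ ccSet μ w ℂ) : Continuous fun t => translate hw t F := by
  obtain ⟨f, hf, hfc, hFf⟩ := hF
  refine continuous_iff_continuousAt.2 fun t₀ => ?_
  obtain ⟨N, hN, hNt⟩ := exists_compact_mem_nhds t₀
  have hφ : ContinuousOn (fun t => ∫ s, w s * ‖f (s - t) - f (s - t₀)‖ ∂μ) N := by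
    refine continuousOn_integral_of_compact_support (hN.add hfc.isCompact) ?_ ?_
    · have := hw.continuous
      refine Continuous.continuousOn ?_
      fun_prop
    · intro t s ht hs
      have h : ∀ t ∈ N, f (s - t) = 0 := fun t ht => by
        by_contra h
        exact hs ⟨t, ht, s - t, subset_tsupport f h, add_sub_cancel _ _⟩
      simp [h t ht, h t₀ (mem_of_mem_nhds hNt)]
  have hφt := hφ.continuousAt hNt
  rw [ContinuousAt, tendsto_iff_norm_sub_tendsto_zero]
  simp only [ContinuousAt, sub_self, norm_zero, mul_zero, integral_zero] at hφt
  refine hφt.congr fun t => ?_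
  rw [norm_eq_integral hw.continuous hw.pos]
  refine integral_congr_ae ?_
  filter_upwards [coeFn_sub hw.continuous hw.pos (translate hw t F) (translate hw t₀ F),
    coeFn_translate hw t F, coeFn_translate hw t₀ F, ae_comp_sub_right hFf t,
    ae_comp_sub_right hFf t₀] with s h1 h2 h3 h4 h5
  rw [h1, h2, h3, h4, h5]

end Translate

theorem isConvolution_of_ae_eq [μ.IsAddLeftInvariant] [μ.IsNegInvariant] {E F K : L1 μ w ℂ}
    {e f : G → ℂ} (hE : E =ᵐ[μ] e) (hF : F =ᵐ[μ] f)
    (hK : K =ᵐ[μ] fun s => ∫ t, e t * f (s - t) ∂μ) : IsConvolution E F K := by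
  refine hK.trans (ae_of_all _ fun s => integral_congr_ae ?_)
  filter_upwards [hE,
    (Measure.measurePreserving_sub_left μ s).quasiMeasurePreserving.ae hF] with t h1 h2
  rw [h1, h2]

/-- A continuous probability density with compact support contained in a given neighbourhood of
the neutral element. -/
theorem exists_bump [LocallyCompactSpace G] [T2Space G] [μ.IsAddHaarMeasure] {U : Set G}
    (hU : U ∈ 𝓝 (0 : G)) :
    ∃ e : G → ℝ, Continuous e ∧ HasCompactSupport e ∧ (∀ t, 0 ≤ e t) ∧ ∫ t, e t ∂μ = 1 ∧
      ∀ t, e t ≠ 0 → t ∈ U := by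
  obtain ⟨φ, h1, h0, hc, hφ⟩ := exists_continuous_one_zero_of_isCompact
    (isCompact_singleton (x := 0)) (isOpen_interior (s := U)).isClosed_compl
    (Set.disjoint_singleton_left.2 fun h => h (mem_interior_iff_mem_nhds.2 hU))
  have hpos : 0 < ∫ t, φ t ∂μ :=
    φ.continuous.integral_pos_of_hasCompactSupport_nonneg_nonzero hc (fun t => (hφ t).1)
      (x := 0) (by simp [h1 rfl])
  refine ⟨fun t => (∫ t, φ t ∂μ)⁻¹ * φ t, by fun_prop, hc.mul_left,
    fun t => mul_nonneg (inv_nonneg.2 hpos.le) (hφ t).1, ?_, fun t ht => ?_⟩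
  · rw [integral_const_mul, inv_mul_cancel₀ hpos.ne']
  · by_contra h
    exact ht (by simp [h0 (show t ∈ (interior U)ᶜ from fun h' => h (interior_subset h'))])

omit [MeasurableSpace G] [BorelSpace G] in
/-- Uniform continuity of `f`, stated through translations. -/
theorem eventually_norm_sub_le {f : G → ℂ} (hf : Continuous f) (hfc : HasCompactSupport f) {ε : ℝ}
    (hε : 0 < ε) : ∀ᶠ u in 𝓝 (0 : G), ∀ s, ‖f (s - u) - f s‖ ≤ ε := by
  let _ := IsTopologicalAddGroup.rightUniformSpace G
  have _ := isUniformAddGroup_of_addCommGroup (G := G)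
  have huc := hfc.uniformContinuous_of_continuous hf
  have h := huc (Metric.dist_mem_uniformity hε)
  rw [mem_map, uniformity_eq_comap_nhds_zero, mem_comap] at h
  obtain ⟨V, hV, hVs⟩ := h
  filter_upwards [hV] with u hu s
  have : (s - u, s) ∈ (fun x : G × G => x.2 - x.1) ⁻¹' V := by simpa using hu
  have := hVs this
  rw [← dist_eq_norm]
  exact le_of_lt this

section ApproxIdentity

variable [LocallyCompactSpace G] [T2Space G] [μ.IsAddHaarMeasure]

omit [LocallyCompactSpace G] [T2Space G] in
theorem norm_integral_bump_sub_le {e : G → ℝ} (he : Continuous e)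
    (hec : HasCompactSupport e) (he0 : ∀ t, 0 ≤ e t) (he1 : ∫ t, e t ∂μ = 1) {f : G → ℂ}
    (hf : Continuous f) {ε : ℝ} {s : G} (h : ∀ u, e u ≠ 0 → ‖f (s - u) - f s‖ ≤ ε) :
    ‖(∫ u, (e u : ℂ) * f (s - u) ∂μ) - f s‖ ≤ ε := by
  have hec' : HasCompactSupport fun u => (e u : ℂ) :=
    hec.comp_left (g := ((↑) : ℝ → ℂ)) Complex.ofReal_zero
  have hi1 : Integrable (fun u => (e u : ℂ) * f (s - u)) μ :=
    Continuous.integrable_of_hasCompactSupport (by fun_prop) hec'.mul_right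
  have hi2 : Integrable (fun u => (e u : ℂ) * f s) μ :=
    Continuous.integrable_of_hasCompactSupport (by fun_prop) hec'.mul_right
  have h1 : ∫ u, (e u : ℂ) * f s ∂μ = f s := by
    rw [integral_mul_const, integral_complex_ofReal, he1, Complex.ofReal_one, one_mul]
  calc ‖(∫ u, (e u : ℂ) * f (s - u) ∂μ) - f s‖
      = ‖∫ u, ((e u : ℂ) * f (s - u) - (e u : ℂ) * f s) ∂μ‖ := by rw [integral_sub hi1 hi2, h1]
    _ ≤ ∫ u, e u * ε ∂μ := by
        refine norm_integral_le_of_norm_le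
          ((he.integrable_of_hasCompactSupport hec).mul_const ε) (ae_of_all _ fun u => ?_)
        rw [← mul_sub, norm_mul, Complex.norm_real, Real.norm_of_nonneg (he0 u)]
        by_cases hu : e u = 0
        · simp [hu]
        · exact mul_le_mul_of_nonneg_left (h u hu) (he0 u)
    _ = ε := by rw [integral_mul_const, he1, one_mul]

/-- The Beurling algebra has a bounded approximate identity. Only products `K i = E i * F` with `F`
in `C_c(G)` are considered; they are classes of functions in `C_c(G)`. -/
theorem exists_approximate_identity [μ.Regular] (hw : IsWeight w) :
    ∃ (l : Filter (Set G)) (_ : l.NeBot) (E : Set G → L1 μ w ℂ), (∀ i, ‖E i‖ ≤ 2) ∧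
      ∀ F ∈ ccSet μ w ℂ, ∃ K : Set G → L1 μ w ℂ, (∀ i, IsConvolution (E i) F (K i)) ∧
        Tendsto K l (𝓝 F) := by
  -- the bound `w ≤ 2` on the supports keeps the norms bounded; the bumps are indexed by all sets `U`,
  -- so that containment in `U` can only be asked of neighbourhoods
  have hex : ∀ U : Set G, ∃ e : G → ℝ, Continuous e ∧ HasCompactSupport e ∧ (∀ t, 0 ≤ e t) ∧
      ∫ t, e t ∂μ = 1 ∧ (∀ t, e t ≠ 0 → w t ≤ 2) ∧ (U ∈ 𝓝 (0 : G) → ∀ t, e t ≠ 0 → t ∈ U) := by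
    intro U
    have h2 : {t | w t ≤ 2} ∈ 𝓝 (0 : G) :=
      hw.continuous.continuousAt.eventually_le_const (by rw [hw.zero]; norm_num)
    by_cases hU : U ∈ 𝓝 (0 : G)
    · obtain ⟨e, a, b, c, d, h⟩ := exists_bump (μ := μ) (inter_mem h2 hU)
      exact ⟨e, a, b, c, d, fun t ht => (h t ht).1, fun _ t ht => (h t ht).2⟩
    · obtain ⟨e, a, b, c, d, h⟩ := exists_bump (μ := μ) h2
      exact ⟨e, a, b, c, d, h, fun h => absurd h hU⟩
  choose e he hec he0 he1 he2 heU using hex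
  have he' : ∀ U, Continuous fun t => (e U t : ℂ) := fun U => Complex.continuous_ofReal.comp (he U)
  have hec' : ∀ U, HasCompactSupport fun t => (e U t : ℂ) := fun U =>
    (hec U).comp_left (g := ((↑) : ℝ → ℂ)) Complex.ofReal_zero
  have hm : ∀ U, MemLp (fun t => (e U t : ℂ)) 1 (weightedMeasure μ w) := fun U =>
    memLp_cc hw.continuous hw.pos (he' U) (hec' U)
  -- `smallSets` contains sets that are not neighbourhoods, such as `∅`; these are discarded
  refine ⟨(𝓝 0).smallSets ⊓ 𝓟 {U | U ∈ 𝓝 0},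
    frequently_mem_iff_neBot.1 (frequently_smallSets_mem _), fun U => (hm U).toLp _, fun U => ?_, ?_⟩
  · calc ‖(hm U).toLp _‖ = ∫ t, w t * ‖(hm U).toLp _ t‖ ∂μ :=
          norm_eq_integral hw.continuous hw.pos _
      _ ≤ ∫ t, 2 * e U t ∂μ := by
          refine integral_mono_ae (integrable_mul_norm hw.continuous hw.pos _)
            (((he U).integrable_of_hasCompactSupport (hec U)).const_mul 2) ?_
          filter_upwards [coeFn_toLp hw.continuous hw.pos (hm U)] with t ht
          rw [ht, Complex.norm_real, Real.norm_of_nonneg (he0 U t)]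
          by_cases h : e U t = 0
          · simp [h]
          · exact mul_le_mul_of_nonneg_right (he2 U t h) (he0 U t)
      _ = 2 := by rw [integral_const_mul, he1, mul_one]
  rintro F ⟨f, hf, hfc, hFf⟩
  set k : Set G → G → ℂ := fun U s => ∫ u, (e U u : ℂ) * f (s - u) ∂μ with hk
  have hkc : ∀ U, Continuous (k U) := fun U =>
    hfc.continuous_convolution_right (ContinuousLinearMap.mul ℂ ℂ)
      ((he' U).locallyIntegrable) hf
  have hks : ∀ U, HasCompactSupport (k U) := fun U =>
    HasCompactSupport.convolution (ContinuousLinearMap.mul ℂ ℂ) (hec' U) hfc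
  have hkm : ∀ U, MemLp (k U) 1 (weightedMeasure μ w) := fun U =>
    memLp_cc hw.continuous hw.pos (hkc U) (hks U)
  refine ⟨fun U => (hkm U).toLp _, fun U => isConvolution_of_ae_eq
    (coeFn_toLp hw.continuous hw.pos (hm U)) hFf (coeFn_toLp hw.continuous hw.pos (hkm U)), ?_⟩
  obtain ⟨N, hN, hN0⟩ := exists_compact_mem_nhds (0 : G)
  -- all `k U` with `U ⊆ N`, and `f`, vanish outside the compact set `L`
  set L : Set G := N + tsupport f with hL
  have hLc : IsCompact L := hN.add hfc.isCompact
  have hI : IntegrableOn w L μ := hw.continuous.continuousOn.integrableOn_compact hLc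
  have hI0 : 0 ≤ ∫ t in L, w t ∂μ := integral_nonneg fun t => (hw.pos t).le
  refine Metric.tendsto_nhds.2 fun ε hε => ?_
  set δ := ε / 2 / (1 + ∫ t in L, w t ∂μ) with hδ
  have hδ0 : 0 < δ := by positivity
  have hev := eventually_norm_sub_le hf hfc hδ0
  filter_upwards [Eventually.filter_mono inf_le_left (eventually_smallSets_subset.2
    (inter_mem hN0 hev)), Eventually.filter_mono inf_le_right (mem_principal_self _)] with U hU hU0
  have hkf : ∀ s, ‖k U s - f s‖ ≤ L.indicator (fun _ => δ) s := fun s => by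
    by_cases hs : s ∈ L
    · rw [Set.indicator_of_mem hs]
      exact norm_integral_bump_sub_le (he U) (hec U) (he0 U) (he1 U) hf
        fun u hu => (hU (heU U hU0 u hu)).2 s
    · have h0 : f s = 0 := by
        by_contra h
        exact hs ⟨0, mem_of_mem_nhds hN0, s, subset_tsupport f h, zero_add s⟩
      have h1 : k U s = 0 := by
        refine integral_eq_zero_of_ae (ae_of_all _ fun u => ?_)
        by_contra h
        obtain ⟨hu, hf⟩ := mul_ne_zero_iff.1 h
        exact hs ⟨u, (hU (heU U hU0 u (by simpa using hu))).1, s - u, subset_tsupport f hf,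
          add_sub_cancel _ _⟩
      simp [h0, h1, hs]
  calc dist ((hkm U).toLp _) F = ∫ t, w t * ‖((hkm U).toLp _ - F) t‖ ∂μ := by
        rw [dist_eq_norm, norm_eq_integral hw.continuous hw.pos]
    _ ≤ ∫ t, L.indicator (fun t => w t * δ) t ∂μ := by
        refine integral_mono_ae (integrable_mul_norm hw.continuous hw.pos _)
          ((integrable_indicator_iff hLc.measurableSet).2 (hI.mul_const δ)) ?_
        filter_upwards [coeFn_sub hw.continuous hw.pos ((hkm U).toLp _) F,
          coeFn_toLp hw.continuous hw.pos (hkm U), hFf] with t h1 h2 h3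
        rw [h1, h2, h3, Set.indicator_mul_right]
        exact mul_le_mul_of_nonneg_left (hkf t) (hw.pos t).le
    _ = (∫ t in L, w t ∂μ) * δ := by
        rw [integral_indicator hLc.measurableSet, integral_mul_const]
    _ ≤ (1 + ∫ t in L, w t ∂μ) * δ := by gcongr; linarith
    _ = ε / 2 := by rw [hδ]; field_simp
    _ < ε := half_lt_self hε

end ApproxIdentity

end Algebra

/-! ### Point masses acting on an essential module -/

theorem equicontinuous_of_norm_le {ι E F : Type*} [NormedAddCommGroup E] [NormedSpace ℂ E]
    [NormedAddCommGroup F] [NormedSpace ℂ F] {A : ι → E →L[ℂ] F} {C : ℝ} (h : ∀ i, ‖A i‖ ≤ C) :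
    Equicontinuous fun i => ⇑(A i) := by
  have H : (∃ C, ∀ i, ‖A i‖ ≤ C) ↔ Equicontinuous (DFunLike.coe ∘ A) :=
    (NormedSpace.equicontinuous_TFAE A).out 5 1
  exact H.1 ⟨C, h⟩

section PointAction

variable {G : Type*} [AddCommGroup G] [TopologicalSpace G] [IsTopologicalAddGroup G]
  [LocallyCompactSpace G] [T2Space G] [MeasurableSpace G] [BorelSpace G] {μ : Measure G}
  [μ.IsAddHaarMeasure] [μ.Regular] {w : G → ℝ}
  {X : Type*} [NormedAddCommGroup X] [NormedSpace ℂ X]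

namespace BanachModule

variable (M : BanachModule μ w X) (hw : IsWeight w)

/-- For an approximate identity `E`, the operators `x ↦ (δ_t * E i) x` converge to the sought
action of `δ_t` on the elements `f x`. -/
theorem tendsto_act_translate {ι : Type*} {l : Filter ι} {E : ι → L1 μ w ℂ}
    (hE : ∀ i, ‖E i‖ ≤ 2) (hconv : ∀ F ∈ ccSet μ w ℂ, ∃ K : ι → L1 μ w ℂ,
      (∀ i, IsConvolution (E i) F (K i)) ∧ Tendsto K l (𝓝 F)) (t : G) (f : L1 μ w ℂ) (x : X) :
    Tendsto (fun i => M.act (translate hw t (E i)) (M.act f x)) l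
      (𝓝 (M.act (translate hw t f) x)) := by
  let A : ι → L1 μ w ℂ →L[ℂ] X := fun i =>
    (M.act (translate hw t (E i))).comp (M.act.flip x)
  let B : L1 μ w ℂ →L[ℂ] X := (M.act.flip x).comp (translateL hw t)
  have hA : Equicontinuous fun i => ⇑(A i) := by
    refine equicontinuous_of_norm_le (C := ‖M.act‖ * (w t * 2) * ‖M.act.flip x‖)
      fun i => (ContinuousLinearMap.opNorm_comp_le _ _).trans ?_
    have h1 : ‖translate hw t (E i)‖ ≤ w t * 2 :=
      (norm_translate_le hw t _).trans (mul_le_mul_of_nonneg_left (hE i) (hw.pos t).le)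
    exact mul_le_mul_of_nonneg_right (M.act.le_opNorm_of_le h1) (norm_nonneg _)
  have hcl : IsClosed {f | Tendsto (fun i => A i f) l (𝓝 (B f))} :=
    hA.isClosed_setOfPred_tendsto B.continuous
  refine hcl.closure_subset_iff.2 ?_ (dense_ccSet hw.continuous hw.pos f)
  intro F hF
  obtain ⟨K, hK, hlim⟩ := hconv F hF
  refine ((B.continuous.tendsto F).comp hlim).congr fun i => ?_
  exact M.act_conv _ _ _ ((hK i).translate hw t) x

/-- Existence of `δ_t` on an essential module: the operators of `tendsto_act_translate` are
bounded uniformly in `i`, so `∑ fᵢ ⊗ xᵢ ↦ ∑ (δ_t * fᵢ) xᵢ` is bounded by `∑ fᵢ xᵢ` and factors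
through the dense span of the elements `f x`. -/
theorem exists_isPointAction [CompleteSpace X] (hM : M.IsEssential) (t : G) :
    ∃ T, M.IsPointAction hw t T ∧ ‖T‖ ≤ ‖M.act‖ * 2 * w t := by
  obtain ⟨l, _, E, hE, hconv⟩ := exists_approximate_identity (μ := μ) hw
  let a : TensorProduct ℂ (L1 μ w ℂ) X →ₗ[ℂ] X := TensorProduct.lift
    (LinearMap.mk₂ ℂ (fun f x => M.act f x) (by simp) (by simp) (by simp) (by simp))
  let b : TensorProduct ℂ (L1 μ w ℂ) X →ₗ[ℂ] X := TensorProduct.lift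
    (LinearMap.mk₂ ℂ (fun f x => M.act (translateL hw t f) x) (by simp) (by simp) (by simp)
      (by simp))
  have ha : DenseRange a := by
    refine Dense.mono ?_ hM
    rw [← LinearMap.coe_range, SetLike.coe_subset_coe, Submodule.span_le]
    rintro _ ⟨f, x, rfl⟩
    exact ⟨f ⊗ₜ[ℂ] x, by simp [a]⟩
  have hlim : ∀ z, Tendsto (fun i => M.act (translate hw t (E i)) (a z)) l (𝓝 (b z)) := by
    intro z
    induction z with
    | zero => simp
    | tmul f x => simpa [a, b, translateL_apply] using M.tendsto_act_translate hw hE hconv t f x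
    | add y z hy hz => simpa using hy.add hz
  have hab : ∀ z, ‖b z‖ ≤ ‖M.act‖ * 2 * w t * ‖a z‖ := fun z => by
    refine le_of_tendsto (hlim z).norm (Eventually.of_forall fun i => ?_)
    refine (M.act _).le_of_opNorm_le ?_ _
    refine (M.act.le_opNorm_of_le ((norm_translate_le hw t _).trans
      (mul_le_mul_of_nonneg_left (hE i) (hw.pos t).le))).trans_eq (by ring)
  refine ⟨b.extendOfNorm a, fun f x => ?_, LinearMap.opNorm_extendOfNorm_le ha
    (mul_nonneg (by positivity) (hw.pos t).le) hab⟩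
  simpa [a, b, translateL_apply] using LinearMap.extendOfNorm_eq ha ⟨_, hab⟩ (f ⊗ₜ[ℂ] x)

variable [CompleteSpace X] {M} (hM : M.IsEssential)
include hM

theorem isPointAction_pointAct (t : G) : M.IsPointAction hw t (M.pointAct hw t) := by
  have h : ∃ T, M.IsPointAction hw t T := (M.exists_isPointAction hw hM t).imp fun _ h => h.1
  rw [pointAct, dif_pos h]
  exact h.choose_spec

theorem norm_pointAct_le (t : G) : ‖M.pointAct hw t‖ ≤ ‖M.act‖ * 2 * w t := by
  obtain ⟨T, hT, hn⟩ := M.exists_isPointAction hw hM t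
  rwa [(isPointAction_pointAct hw hM t).unique hM hT]

theorem pointAct_pointAct (s t : G) (x : X) :
    M.pointAct hw s (M.pointAct hw t x) = M.pointAct hw (s + t) x := by
  have h : M.IsPointAction hw (s + t) ((M.pointAct hw s).comp (M.pointAct hw t)) := fun f x => by
    rw [ContinuousLinearMap.comp_apply, isPointAction_pointAct hw hM t,
      isPointAction_pointAct hw hM s, translate_translate]
  exact congr($(h.unique hM (isPointAction_pointAct hw hM (s + t))) x)

theorem pointAct_zero (x : X) : M.pointAct hw 0 x = x := by
  have h : M.IsPointAction hw 0 (ContinuousLinearMap.id ℂ X) := fun f x => by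
    rw [translate_zero, ContinuousLinearMap.id_apply]
  exact congr($((isPointAction_pointAct hw hM 0).unique hM h) x)

theorem continuous_pointAct (x : X) : Continuous fun t => M.pointAct hw t x := by
  -- the normalized operators `S t` are uniformly bounded, which makes continuity in `t` a closed
  -- condition on the vector
  let S : G → X →L[ℂ] X := fun t => ((w t)⁻¹ : ℂ) • M.pointAct hw t
  have hwc : Continuous fun t => (w t : ℂ) := Complex.continuous_ofReal.comp hw.continuous
  have hw0 : ∀ t, (w t : ℂ) ≠ 0 := fun t => Complex.ofReal_ne_zero.2 (hw.pos t).ne'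
  suffices h : ∀ t₀ x, Tendsto (fun t => S t x) (𝓝 t₀) (𝓝 (S t₀ x)) by
    have hS : Continuous fun t => (w t : ℂ) • S t x :=
      hwc.smul (continuous_iff_continuousAt.2 fun t₀ => h t₀ x)
    refine hS.congr fun t => ?_
    rw [_root_.smul_apply, smul_inv_smul₀ (hw0 t)]
  intro t₀
  have hS : Equicontinuous fun t => ⇑(S t) := by
    refine equicontinuous_of_norm_le (C := ‖M.act‖ * 2) fun t => ?_
    rw [norm_smul, norm_inv, Complex.norm_real, Real.norm_of_nonneg (hw.pos t).le,
      inv_mul_le_iff₀ (hw.pos t), mul_comm (w t)]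
    exact norm_pointAct_le hw hM t
  have hcl : IsClosed {x | Tendsto (fun t => S t x) (𝓝 t₀) (𝓝 (S t₀ x))} :=
    hS.isClosed_setOfPred_tendsto (S t₀).continuous
  refine fun x => hcl.closure_subset_iff.2 (fun y hy => ?_) (hM x)
  refine Submodule.span_induction ?_ ?_ ?_ ?_ hy
  · rintro _ ⟨f, x, rfl⟩
    have hcl' : IsClosed {f | M.act f x ∈ {x | Tendsto (fun t => S t x) (𝓝 t₀) (𝓝 (S t₀ x))}} :=
      hcl.preimage (M.act.flip x).continuous
    refine hcl'.closure_subset_iff.2 (fun F hF => ?_) (dense_ccSet hw.continuous hw.pos f)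
    have h : Continuous fun t => ((w t)⁻¹ : ℂ) • M.act (translate hw t F) x :=
      (hwc.inv₀ hw0).smul ((M.act.flip x).continuous.comp (continuous_translate_of_mem_ccSet hw hF))
    have h' : Continuous fun t => S t (M.act F x) := by
      refine h.congr fun t => ?_
      rw [← isPointAction_pointAct hw hM t, _root_.smul_apply]
    exact h'.tendsto t₀
  · simp
  · intro x y _ _ hx hy
    simpa using hx.add hy
  · intro c x _ hx
    simpa using hx.const_smul c

/-- Joint continuity follows from strong continuity and local boundedness of `t ↦ ‖δ_t‖`. -/
theorem continuous_pointAct_apply : Continuous fun p : G × X => M.pointAct hw p.1 p.2 := by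
  refine continuous_iff_continuousAt.2 fun p₀ => ?_
  rw [ContinuousAt, tendsto_iff_norm_sub_tendsto_zero]
  have hlim : Tendsto (fun p : G × X => ‖M.act‖ * 2 * w p.1 * ‖p.2 - p₀.2‖ +
      ‖M.pointAct hw p.1 p₀.2 - M.pointAct hw p₀.1 p₀.2‖) (𝓝 p₀) (𝓝 0) := by
    have h1 := hw.continuous
    have h2 := (continuous_pointAct hw hM p₀.2).comp (continuous_fst (X := G) (Y := X))
    have h : Continuous (fun p : G × X => ‖M.act‖ * 2 * w p.1 * ‖p.2 - p₀.2‖ +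
      ‖M.pointAct hw p.1 p₀.2 - M.pointAct hw p₀.1 p₀.2‖) :=
      .add (by fun_prop) (h2.sub continuous_const).norm
    simpa using h.tendsto p₀
  refine squeeze_zero (fun _ => norm_nonneg _) (fun p => ?_) hlim
  calc ‖M.pointAct hw p.1 p.2 - M.pointAct hw p₀.1 p₀.2‖
      = ‖M.pointAct hw p.1 (p.2 - p₀.2) +
          (M.pointAct hw p.1 p₀.2 - M.pointAct hw p₀.1 p₀.2)‖ := by rw [map_sub]; congr 1; abel
    _ ≤ _ := (norm_add_le _ _).trans (add_le_add_left
        ((M.pointAct hw p.1).le_of_opNorm_le (norm_pointAct_le hw hM p.1) _) _)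

theorem continuous_pointAct_comp {Y : Type*} [TopologicalSpace Y] {a : Y → G} {b : Y → X}
    (ha : Continuous a) (hb : Continuous b) : Continuous fun y => M.pointAct hw (a y) (b y) := by
  have h := (continuous_pointAct_apply hw hM).comp (ha.prodMk hb)
  exact h

end BanachModule

end PointAction

/-! ### Density of the image of a kernel -/

/-- If `Λ` has dense range and `Π ∘ Λ` is onto, then `Λ` maps `ker (Π ∘ Λ)` densely into `ker Π`:
an approximant `Λ h` of a point of `ker Π` has small image under `Π`, and by the open mapping
theorem `h` is moved into `ker (Π ∘ Λ)` by a small correction. -/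
theorem ker_subset_closure_image_ker {A B X : Type*} [NormedAddCommGroup A] [NormedSpace ℂ A]
    [CompleteSpace A] [NormedAddCommGroup B] [NormedSpace ℂ B] [NormedAddCommGroup X]
    [NormedSpace ℂ X] [CompleteSpace X] {L : A →L[ℂ] B} {P : B →L[ℂ] X} {Q : A →L[ℂ] X}
    (hL : DenseRange L) (hQ : Function.Surjective Q) (h : ∀ a, P (L a) = Q a) :
    {b | P b = 0} ⊆ closure (L '' {a | Q a = 0}) := by
  obtain ⟨C, hC, hpre⟩ := Q.exists_preimage_norm_le hQ
  intro b (hb : P b = 0)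
  refine Metric.mem_closure_iff.2 fun ε hε => ?_
  have hc : 0 < 1 + ‖L‖ * (C * ‖P‖) := by positivity
  obtain ⟨a, ha⟩ := hL.exists_dist_lt b (div_pos hε hc)
  obtain ⟨k, hk, hkn⟩ := hpre (Q a)
  refine ⟨L (a - k), ⟨a - k, by simp [hk], rfl⟩, ?_⟩
  rw [dist_eq_norm] at ha ⊢
  have hQa : ‖Q a‖ ≤ ‖P‖ * ‖b - L a‖ := by
    have := P.le_opNorm (b - L a)
    rwa [map_sub, hb, zero_sub, norm_neg, h] at this
  calc ‖b - L (a - k)‖ = ‖(b - L a) + L k‖ := by rw [map_sub]; congr 1; abel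
    _ ≤ ‖b - L a‖ + ‖L‖ * (C * (‖P‖ * ‖b - L a‖)) :=
        (norm_add_le _ _).trans (add_le_add_right (L.le_opNorm_of_le
          (hkn.trans (mul_le_mul_of_nonneg_left hQa hC.le))) _)
    _ = (1 + ‖L‖ * (C * ‖P‖)) * ‖b - L a‖ := by ring
    _ < ε := by rwa [mul_comm, ← lt_div_iff₀ hc]

end Beurling

/-! ### The operators `Λ_X`, `Φ` and `Π` -/

theorem theoremT {G : Type*} [AddCommGroup G] [TopologicalSpace G] [IsTopologicalAddGroup G]
    [LocallyCompactSpace G] [T2Space G] [MeasurableSpace G] [BorelSpace G]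
    (μ : Measure G) [μ.IsAddHaarMeasure] [μ.Regular]
    (ω σ : G → ℝ) (hω : Beurling.IsWeight ω) (hσ : Beurling.IsWeight σ)
    (h1 : ∀ t, 1 ≤ ω t) (h2 : ∀ t, σ t ≤ ω t) (h3 : ∀ t, 1 ≤ ω t * σ (-t))
    {X : Type*} [NormedAddCommGroup X] [NormedSpace ℂ X] [CompleteSpace X]
    (M : Beurling.BanachModule μ σ X) (hM : M.IsEssential) :
    -- the action of the point masses on `X` is well defined and strongly continuous
    (∀ t, M.IsPointAction hσ t (M.pointAct hσ t)) ∧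
    (∀ x, Continuous fun t => M.pointAct hσ t x) ∧
    -- the operators `Lam = Λ_X`, `Phi = Φ`, `Pi = Π` exist as bounded operators given by their defining formulas
    ∃ (Lam : Beurling.L1 μ (fun t => ω t * σ (-t)) X →L[ℂ] Beurling.L1 μ ω X)
      (Phi : Beurling.L1 μ (fun t => ω t * σ (-t)) X →L[ℂ] X)
      (Pi : Beurling.L1 μ ω X →L[ℂ] X),
      (∀ f : Beurling.L1 μ (fun t => ω t * σ (-t)) X, Lam f =ᵐ[μ] fun t => M.pointAct hσ (-t) (f t)) ∧
      (∀ f : Beurling.L1 μ (fun t => ω t * σ (-t)) X, Integrable f μ ∧ Phi f = ∫ t, f t ∂μ) ∧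
      (∀ f : Beurling.L1 μ ω X, Integrable (fun t => M.pointAct hσ t (f t)) μ ∧
        Pi f = ∫ t, M.pointAct hσ t (f t) ∂μ) ∧
      -- `Lam (ker Phi)` is a dense subset of `ker Pi`
      Lam '' {f | Phi f = 0} ⊆ {g | Pi g = 0} ∧
      {g | Pi g = 0} ⊆ closure (Lam '' {f | Phi f = 0}) ∧
      -- and it is all of `ker Pi` when `σ = 1`
      ((∀ t, σ t = 1) → Lam '' {f | Phi f = 0} = {g | Pi g = 0}) := by
  have hc : Continuous fun t => ω t * σ (-t) :=
    hω.continuous.mul (hσ.continuous.comp continuous_neg)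
  have hp : ∀ t, 0 < ω t * σ (-t) := fun t => one_pos.trans_le (h3 t)
  have hT := Beurling.BanachModule.continuous_pointAct_apply hσ hM
  have hT' : Continuous fun p : G × X => M.pointAct hσ (-p.1) p.2 :=
    Beurling.BanachModule.continuous_pointAct_comp hσ hM continuous_fst.neg continuous_snd
  have hn := Beurling.BanachModule.norm_pointAct_le hσ hM
  have hinv : ∀ t x, M.pointAct hσ t (M.pointAct hσ (-t) x) = x := fun t x => by
    rw [Beurling.BanachModule.pointAct_pointAct hσ hM, add_neg_cancel,
      Beurling.BanachModule.pointAct_zero hσ hM]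
  have hinv' : ∀ t x, M.pointAct hσ (-t) (M.pointAct hσ t x) = x := fun t x => by
    simpa using hinv (-t) x
  have hbL : ∀ t, ω t * ‖M.pointAct hσ (-t)‖ ≤ ‖M.act‖ * 2 * (ω t * σ (-t)) := fun t =>
    (mul_le_mul_of_nonneg_left (hn (-t)) (hω.pos t).le).trans_eq (by ring)
  have hbP : ∀ t, (1 : ℝ) * ‖M.pointAct hσ t‖ ≤ ‖M.act‖ * 2 * ω t := fun t => by
    rw [one_mul]
    exact (hn t).trans (mul_le_mul_of_nonneg_left (h2 t) (by positivity))
  obtain ⟨Lam, hLam⟩ : ∃ Lam : Beurling.L1 μ (fun t => ω t * σ (-t)) X →L[ℂ] Beurling.L1 μ ω X,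
      ∀ f, Lam f =ᵐ[μ] fun t => M.pointAct hσ (-t) (f t) :=
    ⟨_, Beurling.coeFn_fiberwise hc hp hω.continuous hω.pos hT' hbL⟩
  obtain ⟨Phi, hPhi⟩ : ∃ Phi : Beurling.L1 μ (fun t => ω t * σ (-t)) X →L[ℂ] X,
      ∀ f, Phi f = ∫ t, f t ∂μ := ⟨_, Beurling.integralL1_apply hc h3⟩
  obtain ⟨R, hR⟩ : ∃ R : Beurling.L1 μ ω X →L[ℂ] Beurling.L1 μ (fun _ => (1 : ℝ)) X,
      ∀ g, R g =ᵐ[μ] fun t => M.pointAct hσ t (g t) :=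
    ⟨_, Beurling.coeFn_fiberwise hω.continuous hω.pos continuous_const (fun _ => one_pos) hT hbP⟩
  obtain ⟨Pi, hPi⟩ : ∃ Pi : Beurling.L1 μ ω X →L[ℂ] X,
      ∀ g, Pi g = ∫ t, M.pointAct hσ t (g t) ∂μ :=
    ⟨(Beurling.integralL1 continuous_const fun _ => le_rfl).comp R, fun g => by
      rw [ContinuousLinearMap.comp_apply, Beurling.integralL1_apply]
      exact integral_congr_ae (hR g)⟩
  have hPL : ∀ f, Pi (Lam f) = Phi f := fun f => by
    rw [hPi, hPhi]
    refine integral_congr_ae ?_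
    filter_upwards [hLam f] with t ht
    rw [ht, hinv]
  have hsub : Lam '' {f | Phi f = 0} ⊆ {g | Pi g = 0} := by
    rintro _ ⟨f, hf, rfl⟩
    exact (hPL f).trans hf
  have hdense : DenseRange Lam := by
    -- the range of `Lam` contains `C_c(G, X)`, since `t ↦ δ_t (g t)` is in `C_c` when `g` is
    suffices hcc : Beurling.ccSet μ ω X ⊆ Set.range Lam from
      (Beurling.dense_ccSet hω.continuous hω.pos).mono hcc
    rintro G₀ ⟨g, hg, hgc, hGg⟩
    have hcont : Continuous fun t => M.pointAct hσ t (g t) :=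
      Beurling.BanachModule.continuous_pointAct_comp hσ hM continuous_id hg
    have hsupp : HasCompactSupport fun t => M.pointAct hσ t (g t) := by
      refine hgc.mono (Function.support_subset_iff'.2 fun t ht => ?_)
      rw [Function.notMem_support.1 ht, map_zero]
    have hm := Beurling.memLp_cc (μ := μ) hc hp hcont hsupp
    refine ⟨hm.toLp _, Beurling.ext_ae hω.continuous hω.pos ?_⟩
    filter_upwards [hLam (hm.toLp _), Beurling.coeFn_toLp hc hp hm, hGg] with t a b c
    rw [a, b, c, hinv']
  have hsurj : Function.Surjective Phi := by
    intro x
    obtain ⟨e, he, hec, -, he1, -⟩ := Beurling.exists_bump (μ := μ) (univ_mem : _ ∈ 𝓝 (0 : G))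
    have hm := Beurling.memLp_cc (μ := μ) hc hp (g := fun t => e t • x)
      (he.smul continuous_const) hec.smul_right
    refine ⟨hm.toLp _, ?_⟩
    rw [hPhi, integral_congr_ae (Beurling.coeFn_toLp hc hp hm), integral_smul_const, he1, one_smul]
  have hone : (∀ t, σ t = 1) → {g | Pi g = 0} ⊆ Lam '' {f | Phi f = 0} := by
    intro h g (hg : Pi g = 0)
    -- for `σ = 1` the operators `δ_t` are uniformly bounded, and `g ↦ δ_t (g t)` inverts `Lam`
    have hbS : ∀ t, ω t * σ (-t) * ‖M.pointAct hσ t‖ ≤ ‖M.act‖ * 2 * ω t := fun t => by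
      rw [h, mul_one, mul_comm]
      refine mul_le_mul_of_nonneg_right ((hn t).trans_eq ?_) (hω.pos t).le
      rw [h, mul_one]
    obtain ⟨f, hf⟩ : ∃ f : Beurling.L1 μ (fun t => ω t * σ (-t)) X,
        f =ᵐ[μ] fun t => M.pointAct hσ t (g t) :=
      ⟨_, Beurling.coeFn_fiberwise hω.continuous hω.pos hc hp hT hbS g⟩
    have hLf : Lam f = g := by
      refine Beurling.ext_ae hω.continuous hω.pos ?_
      filter_upwards [hLam f, hf] with t a b
      rw [a, b, hinv']
    have hf0 : Phi f = 0 := by rw [← hPL, hLf, hg]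
    exact ⟨f, hf0, hLf⟩
  have hPhi' : ∀ f : Beurling.L1 μ (fun t => ω t * σ (-t)) X,
      Integrable f μ ∧ Phi f = ∫ t, f t ∂μ :=
    fun f => ⟨Beurling.integrable_of_one_le hc h3 f, hPhi f⟩
  have hPi' : ∀ g : Beurling.L1 μ ω X, Integrable (fun t => M.pointAct hσ t (g t)) μ ∧
      Pi g = ∫ t, M.pointAct hσ t (g t) ∂μ := fun g =>
    ⟨(integrable_congr (hR g)).1
      (Beurling.integrable_of_one_le continuous_const (fun _ => le_rfl) (R g)), hPi g⟩
  exact ⟨Beurling.BanachModule.isPointAction_pointAct hσ hM,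
    Beurling.BanachModule.continuous_pointAct hσ hM, Lam, Phi, Pi, hLam, hPhi', hPi', hsub,
    Beurling.ker_subset_closure_image_ker hdense hsurj hPL, fun h => hsub.antisymm (hone h)⟩
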